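/- Let $N$ and $d$ be natural numbers with $3d = 2N$, i.e. $d = 2N/3$, and let $V$ be an $N$-dimensional complex vector space. Let $G(d,N)$ denote the Grassmannian of $d$-dimensional subspaces of $V$. A triple $(V_1,V_2,V_3)$ of subspaces of $V$ is called a feasible strategy if (i) $\dim V_i = d$ for $i=1,2,3$; (ii) $V_i = \bigoplus_{j\neq i} (V_i\cap V_j)$ for $i=1,2,3$; (iii) $V = \bigoplus_{1\le i<j\le 3} (V_i\cap V_j)$. Then the feasible variety $$\mathcal{Z} = \Big\{(V_1,V_2,V_3)\in \prod_{i=1}^3 G(d,N) \;\Big|\; (V_1,V_2,V_3)\text{ is a feasible strategy}\Big\},$$ with the subspace topology induced by the Zariski topology of $\prod_{i=1}^3 G(d,N)$ (as a closed subvariety, by the Plücker embeddings, of the product $\mathbb{P}(\bigwedge^d V)^3$ of projective spaces), has dimension $2N^2/3$. -/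

import Mathlib

open scoped LinearAlgebra.Projectivization

noncomputable section

/-! ### The Zariski topology on a product of projective spaces -/

/-- The product `∏ i, ℙ(E i)` of finitely many complex projective spaces. -/
def MultiProj {ι : Type*} (E : ι → Type*) [∀ i, AddCommGroup (E i)] [∀ i, Module ℂ (E i)] :
    Type _ :=
  ∀ i, ℙ ℂ (E i)

namespace MultiProj

variable {ι : Type*} [DecidableEq ι] {E : ι → Type*}
  [∀ i, AddCommGroup (E i)] [∀ i, Module ℂ (E i)]

variable (E) in
/-- Polynomial expressions on `∏ i, E i`: the variables are the linear coordinates `φ` on the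
factors `E i`, the variable `⟨i, φ⟩` standing for the function `v ↦ φ (v i)`. -/
abbrev Poly : Type _ := MvPolynomial (Σ i, Module.Dual ℂ (E i)) ℂ

/-- The value of a polynomial expression at a vector of `∏ i, E i`. -/
def Poly.value (f : Poly E) (v : ∀ i, E i) : ℂ :=
  MvPolynomial.eval (fun p => p.2 (v p.1)) f

/-- `f` is multihomogeneous: for some `m : ι → ℕ` it is homogeneous of degree `m i` in the
coordinates of the `i`-th factor, for every `i`. -/
def Poly.IsMultihomogeneous (f : Poly E) : Prop :=
  ∃ m : ι → ℕ, MvPolynomial.IsWeightedHomogeneous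
    (fun p : (Σ i, Module.Dual ℂ (E i)) => (Pi.single p.1 1 : ι → ℕ)) f m

/-- The common zero locus in `∏ i, ℙ(E i)` of a set of polynomials. For multihomogeneous
polynomials, the vanishing does not depend on the representative vectors. -/
def zeroLocus (F : Set (Poly E)) : Set (MultiProj E) :=
  {x | ∀ f ∈ F, f.value (fun i => (x i).rep) = 0}

/-- The Zariski topology on `∏ i, ℙ(E i)`: the closed sets are the common zero loci of sets of
multihomogeneous polynomials. -/
instance zariskiTopology : TopologicalSpace (MultiProj E) :=
  TopologicalSpace.ofClosed
    {S | ∃ F : Set (Poly E), (∀ f ∈ F, f.IsMultihomogeneous) ∧ S = zeroLocus F}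
    (by
      refine ⟨{1}, ?_, ?_⟩
      · rintro f rfl
        exact ⟨0, MvPolynomial.isWeightedHomogeneous_one ℂ _⟩
      · ext x
        simp [zeroLocus, Poly.value])
    (by
      intro A hA
      refine ⟨{f | f.IsMultihomogeneous ∧ ∃ F : Set (Poly E), (∀ f ∈ F, f.IsMultihomogeneous) ∧
        zeroLocus F ∈ A ∧ f ∈ F}, fun f hf => hf.1, ?_⟩
      ext x
      constructor
      · rintro hx f ⟨-, F, -, hFA, hf⟩
        exact hx _ hFA f hf
      · intro hx S hS
        obtain ⟨F, hF, rfl⟩ := hA hS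
        exact fun f hf => hx f ⟨hF f hf, F, hF, hS, hf⟩)
    (by
      rintro _ ⟨F, hF, rfl⟩ _ ⟨G, hG, rfl⟩
      refine ⟨{h | ∃ f ∈ F, ∃ g ∈ G, h = f * g}, ?_, ?_⟩
      · rintro _ ⟨f, hf, g, hg, rfl⟩
        obtain ⟨m, hm⟩ := hF f hf
        obtain ⟨n, hn⟩ := hG g hg
        exact ⟨m + n, hm.mul hn⟩
      · ext x
        constructor
        · rintro (hx | hx) _ ⟨f, hf, g, hg, rfl⟩
          · have h := hx f hf
            simp only [Poly.value] at h ⊢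
            rw [map_mul, h, zero_mul]
          · have h := hx g hg
            simp only [Poly.value] at h ⊢
            rw [map_mul, h, mul_zero]
        · intro hx
          by_contra hcon
          rw [Set.mem_union, not_or] at hcon
          obtain ⟨h1, h2⟩ := hcon
          simp only [zeroLocus, Set.mem_ofPred_eq, not_forall] at h1 h2
          obtain ⟨f, hf, hfx⟩ := h1
          obtain ⟨g, hg, hgx⟩ := h2
          have h := hx (f * g) ⟨f, hf, g, hg, rfl⟩
          simp only [Poly.value] at h hfx hgx
          rw [map_mul] at h
          exact (mul_ne_zero hfx hgx) h)

end MultiProj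

/-! ### Grassmannians and their products as varieties -/

/-- The Grassmannian of `d`-dimensional subspaces of `V`. -/
def Gr (V : Type*) [AddCommGroup V] [Module ℂ V] (d : ℕ) : Type _ :=
  {W : Submodule ℂ V // Module.finrank ℂ W = d}

section Grassmannian

variable {V : Type*} [AddCommGroup V] [Module ℂ V] [FiniteDimensional ℂ V]

/-- A basis of a point of the Grassmannian. -/
def Gr.basis {d : ℕ} (W : Gr V d) : Module.Basis (Fin d) ℂ W.1 :=
  Module.finBasisOfFinrankEq ℂ W.1 W.2

theorem Gr.wedge_basis_ne_zero {d : ℕ} (W : Gr V d) :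
    exteriorPower.ιMulti ℂ d (fun j => (W.basis j : V)) ≠ 0 := by
  intro h
  obtain ⟨π, hπ⟩ := W.1.subtype.exists_leftInverse_of_injective W.1.ker_subtype
  have h1 := exteriorPower.alternatingMapLinearEquiv_apply_ιMulti
    (W.basis.det.compLinearMap π) (fun j => (W.basis j : V))
  rw [h, map_zero, AlternatingMap.compLinearMap_apply] at h1
  have h2 : (fun j => π (W.basis j : V)) = W.basis :=
    funext fun j => LinearMap.congr_fun hπ (W.basis j)
  have h3 : W.basis.det (fun j => π (W.basis j : V)) = 1 := by
    rw [h2]; exact W.basis.det_self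
  exact zero_ne_one (h1.trans h3)

/-- The Plücker embedding `span (v₁, …, v_d) ↦ ℂ (v₁ ∧ ⋯ ∧ v_d)`. The point does not depend on
the choice of the basis. -/
def Gr.plucker {d : ℕ} (W : Gr V d) : ℙ ℂ (⋀[ℂ]^d V) :=
  Projectivization.mk ℂ (exteriorPower.ιMulti ℂ d (fun j => (W.basis j : V)))
    W.wedge_basis_ne_zero

/-- The product of Grassmannians `∏ i, G(d i, V)`. -/
def GrProd (V : Type*) [AddCommGroup V] [Module ℂ V] {K : ℕ} (d : Fin K → ℕ) : Type _ :=
  ∀ i, Gr V (d i)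

/-- The product of the Plücker embeddings. -/
def GrProd.plucker {K : ℕ} {d : Fin K → ℕ} (W : GrProd V d) :
    MultiProj (fun i => ⋀[ℂ]^(d i) V) :=
  fun i => (W i).plucker

/-- The Zariski topology on a product of Grassmannians: the one of a subvariety of the product of
projective spaces in which it is embedded. -/
instance GrProd.zariskiTopology {K : ℕ} {d : Fin K → ℕ} : TopologicalSpace (GrProd V d) :=
  TopologicalSpace.induced GrProd.plucker inferInstance

end Grassmannian

/-! ### Feasible strategies -/

section Feasible

variable {V : Type*} [AddCommGroup V] [Module ℂ V]

/-- The subspace `B` is the (internal) direct sum of the family `A` of subspaces. -/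
def IsDirectSumOf {ι : Type*} (B : Submodule ℂ V) (A : ι → Submodule ℂ V) : Prop :=
  iSupIndep A ∧ ⨆ i, A i = B

/-- A feasible strategy for `K` users with degrees of freedom `d i`: a family of subspaces with
`dim (W i) = d i`, `W i = ⨁_{j ≠ i} W i ∩ W j` for all `i`, and `V = ⨁_{i < j} W i ∩ W j`. -/
structure IsFeasibleStrategy {K : ℕ} (d : Fin K → ℕ) (W : Fin K → Submodule ℂ V) : Prop where
  finrank_eq : ∀ i, Module.finrank ℂ (W i) = d i
  eq_directSum : ∀ i, IsDirectSumOf (W i) (fun j : {j : Fin K // j ≠ i} => W i ⊓ W j.1)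
  top_eq_directSum :
    IsDirectSumOf ⊤ (fun p : {p : Fin K × Fin K // p.1 < p.2} => W p.1.1 ⊓ W p.1.2)

/-- The feasible variety: the set of feasible strategies in the product of Grassmannians. As a
subset it carries the subspace topology of the Zariski topology. -/
def feasibleVariety (V : Type*) [AddCommGroup V] [Module ℂ V] {K : ℕ} (d : Fin K → ℕ) :
    Set (GrProd V d) :=
  {W | IsFeasibleStrategy d (fun i => (W i).1)}

end Feasible

end

/-!
# The dimension of the variety of feasible strategies of three users

Write `N = 3m` and `d = 2m`. Three subspaces of dimension `2m` of a space of dimension `3m` form a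
feasible strategy as soon as their intersection is zero: counting dimensions, all pairwise
intersections then have dimension `m`, and the direct sum decompositions follow
(`isFeasibleStrategy_of_iInf_eq_bot`). So the feasible variety contains a nonempty open subset of
`∏ i, G(2m, V)`, and its dimension is that of the product, `3 · m · 2m = 2N² / 3`.

The dimension of the product is computed with affine charts. For a basis of `V` split into two
parts `p`, `q`, the matrices `A` parametrize the graphs `span (p_j + ∑ k, A k j q_k)`. Plücker
coordinates of a graph are polynomials in `A`; conversely the entries of `A` are Plücker coordinates
and another Plücker coordinate is constantly `1`, so polynomials in `A` can be homogenized. Hence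
the chart is an open embedding of affine space with its Zariski topology
(`isOpenEmbedding_grChart`), and there is such a chart around every point.

* Upper bound: dimension is local for open covers, and affine space embeds into the prime spectrum
  of the polynomial ring, whose Krull dimension is known (`GrProd.topologicalKrullDim_le`).
* Lower bound: a nonempty open subset of affine space contains a full flag of irreducible closed
  subsets, cut out by coordinate subspaces (`ZariskiAffine.le_topologicalKrullDim`). In a chart, the
  intersection of the three graphs is the kernel of a square matrix with polynomial entries, so it
  vanishes on a nonempty principal open set (`exists_polyFun_iInf_grChart_eq_bot`).
-/

/-! ### Affine space with its classical Zariski topology -/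

/-- Complex affine space `ℂ^σ`. It is a structure around `σ → ℂ`, so that it can carry the Zariski
topology instead of the product topology. -/
@[ext]
structure ZariskiAffine (σ : Type*) where
  /-- The coordinates of a point. -/
  coord : σ → ℂ

namespace ZariskiAffine

variable {σ τ : Type*}

/-- The Zariski topology, induced by the inclusion of the closed points into the prime spectrum
of the polynomial ring. -/
noncomputable instance : TopologicalSpace (ZariskiAffine σ) :=
  TopologicalSpace.induced
    (fun x => (MvPolynomial.pointToPoint x.coord : PrimeSpectrum (MvPolynomial σ ℂ)))
    inferInstance

theorem isClosed_iff {S : Set (ZariskiAffine σ)} :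
    IsClosed S ↔
      ∃ F : Set (MvPolynomial σ ℂ), S = {x | ∀ f ∈ F, MvPolynomial.eval x.coord f = 0} := by
  have key : ∀ F : Set (MvPolynomial σ ℂ),
      (fun x : ZariskiAffine σ =>
        (MvPolynomial.pointToPoint x.coord : PrimeSpectrum (MvPolynomial σ ℂ))) ⁻¹'
        PrimeSpectrum.zeroLocus F = {x | ∀ f ∈ F, MvPolynomial.eval x.coord f = 0} := by
    intro F
    ext x
    simp [PrimeSpectrum.mem_zeroLocus, MvPolynomial.pointToPoint, Set.subset_def,
      MvPolynomial.aeval_eq_eval]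
  rw [isClosed_induced_iff]
  constructor
  · rintro ⟨t, ht, rfl⟩
    obtain ⟨F, rfl⟩ := (PrimeSpectrum.isClosed_iff_zeroLocus t).1 ht
    exact ⟨F, key F⟩
  · rintro ⟨F, rfl⟩
    exact ⟨_, PrimeSpectrum.isClosed_zeroLocus F, key F⟩

variable (σ) in
/-- The algebra of polynomial functions on `ℂ^σ`. -/
noncomputable def polyFun : Subalgebra ℂ (ZariskiAffine σ → ℂ) :=
  (MvPolynomial.aeval (fun s (x : ZariskiAffine σ) => x.coord s) :
    MvPolynomial σ ℂ →ₐ[ℂ] (ZariskiAffine σ → ℂ)).range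

theorem mem_polyFun {g : ZariskiAffine σ → ℂ} :
    g ∈ polyFun σ ↔ ∃ f : MvPolynomial σ ℂ, ∀ x, MvPolynomial.eval x.coord f = g x := by
  have h : ∀ (f : MvPolynomial σ ℂ) (x : ZariskiAffine σ),
      (MvPolynomial.aeval (fun s (x : ZariskiAffine σ) => x.coord s) f : ZariskiAffine σ → ℂ) x =
        MvPolynomial.eval x.coord f := by
    intro f x
    induction f using MvPolynomial.induction_on with
    | C a => simp
    | add p q hp hq => simp [hp, hq]
    | mul_X p i hp => simp [hp]
  simp only [polyFun, AlgHom.mem_range, funext_iff, h]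

theorem coord_mem_polyFun (s : σ) : (fun x : ZariskiAffine σ => x.coord s) ∈ polyFun σ :=
  mem_polyFun.2 ⟨MvPolynomial.X s, fun x => by simp⟩

theorem const_mem_polyFun (c : ℂ) : (fun _ : ZariskiAffine σ => c) ∈ polyFun σ :=
  (polyFun σ).algebraMap_mem c

theorem eval_comp_mem_polyFun {ι : Type*} (f : MvPolynomial ι ℂ) (g : ι → ZariskiAffine σ → ℂ)
    (hg : ∀ i, g i ∈ polyFun σ) :
    (fun x => MvPolynomial.eval (fun i => g i x) f) ∈ polyFun σ := by
  induction f using MvPolynomial.induction_on with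
  | C a => simpa using const_mem_polyFun a
  | add p q hp hq => simp only [map_add]; exact (polyFun σ).add_mem hp hq
  | mul_X p i hp =>
    simp only [map_mul, MvPolynomial.eval_X]
    exact (polyFun σ).mul_mem hp (hg i)

theorem isClosed_of_polyFun (G : Set (ZariskiAffine σ → ℂ)) (hG : ∀ g ∈ G, g ∈ polyFun σ) :
    IsClosed {x | ∀ g ∈ G, g x = 0} := by
  refine isClosed_iff.2 ⟨{f | ∃ g ∈ G, ∀ x, MvPolynomial.eval x.coord f = g x}, ?_⟩
  ext x
  constructor
  · rintro hx f ⟨g, hg, hfg⟩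
    rw [hfg]
    exact hx g hg
  · intro hx g hg
    obtain ⟨f, hf⟩ := mem_polyFun.1 (hG g hg)
    rw [← hf]
    exact hx f ⟨g, hg, hf⟩

theorem isOpen_ne_zero {g : ZariskiAffine σ → ℂ} (hg : g ∈ polyFun σ) :
    IsOpen {x | g x ≠ 0} := by
  have h := isClosed_of_polyFun {g} (by simpa using hg)
  simpa [Set.compl_ofPred] using h.isOpen_compl

theorem continuous_of_polyFun {f : ZariskiAffine σ → ZariskiAffine τ}
    (hf : ∀ t, (fun x => (f x).coord t) ∈ polyFun σ) : Continuous f := by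
  refine continuous_iff_isClosed.2 fun S hS => ?_
  obtain ⟨F, rfl⟩ := isClosed_iff.1 hS
  have h := isClosed_of_polyFun
    ((fun p : MvPolynomial τ ℂ => fun x => MvPolynomial.eval (f x).coord p) '' F)
    (by
      rintro _ ⟨p, -, rfl⟩
      exact eval_comp_mem_polyFun p (fun t x => (f x).coord t) hf)
  simpa using h

/-- Affine space is irreducible, because a product of nonzero polynomials is nonzero. -/
instance : IrreducibleSpace (ZariskiAffine σ) where
  toNonempty := ⟨⟨fun _ => 0⟩⟩
  isPreirreducible_univ := by
    have key : ∀ U : Set (ZariskiAffine σ), IsOpen U → U.Nonempty →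
        ∃ f : MvPolynomial σ ℂ, f ≠ 0 ∧ ∀ x, MvPolynomial.eval x.coord f ≠ 0 → x ∈ U := by
      rintro U hU ⟨x, hx⟩
      obtain ⟨F, hF⟩ := isClosed_iff.1 hU.isClosed_compl
      have hx' : x ∉ Uᶜ := fun h => h hx
      rw [hF] at hx'
      simp only [Set.mem_ofPred_eq, not_forall] at hx'
      obtain ⟨f, hf, hfx⟩ := hx'
      refine ⟨f, fun h => hfx (by simp [h]), fun y hy => ?_⟩
      by_contra hyU
      have : y ∈ Uᶜ := hyU
      rw [hF] at this
      exact hy (this f hf)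
    rintro U W hU hW ⟨x, -, hx⟩ ⟨y, -, hy⟩
    obtain ⟨f, hf, hfU⟩ := key U hU ⟨x, hx⟩
    obtain ⟨g, hg, hgW⟩ := key W hW ⟨y, hy⟩
    obtain ⟨z, hz⟩ : ∃ z : σ → ℂ, MvPolynomial.eval z (f * g) ≠ 0 := by
      by_contra! h
      exact mul_ne_zero hf hg (MvPolynomial.funext fun z => by simpa using h z)
    rw [map_mul] at hz
    exact ⟨⟨z⟩, trivial, hfU ⟨z⟩ (left_ne_zero_of_mul hz), hgW ⟨z⟩ (right_ne_zero_of_mul hz)⟩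

theorem topologicalKrullDim_le [Finite σ] :
    topologicalKrullDim (ZariskiAffine σ) ≤ (Nat.card σ : ℕ) := by
  refine (Topology.IsInducing.topologicalKrullDim_le (f := fun x : ZariskiAffine σ =>
    (MvPolynomial.pointToPoint x.coord : PrimeSpectrum (MvPolynomial σ ℂ))) ⟨rfl⟩).trans ?_
  rw [PrimeSpectrum.topologicalKrullDim_eq_ringKrullDim,
    MvPolynomial.ringKrullDim_of_isNoetherianRing, ringKrullDim_eq_zero_of_field, zero_add]

/-- A nonempty open subset of affine space contains a full flag of irreducible closed subsets:
its intersections with the coordinate subspaces through one of its points. -/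
theorem le_topologicalKrullDim [Finite σ] {D : Set (ZariskiAffine σ)} (hD : IsOpen D)
    (hne : D.Nonempty) : ((Nat.card σ : ℕ) : WithBot ℕ∞) ≤ topologicalKrullDim D := by
  classical
  obtain ⟨p, hp⟩ := hne
  let e : σ ≃ Fin (Nat.card σ) := Finite.equivFin σ
  -- `φ i` retracts affine space onto the `i`-dimensional coordinate subspace through `p`.
  let φ : ℕ → ZariskiAffine σ → ZariskiAffine σ :=
    fun i x => ⟨fun s => if (e s : ℕ) < i then x.coord s else p.coord s⟩
  have hφ : ∀ i, Continuous (φ i) := fun i => continuous_of_polyFun fun s => by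
    by_cases h : (e s : ℕ) < i
    · simpa [φ, h] using coord_mem_polyFun s
    · simpa [φ, h] using const_mem_polyFun (p.coord s)
  have hφp : ∀ i, φ i p = p := fun i => by ext s; simp [φ]
  have hφφ : ∀ i j, i ≤ j → ∀ x, φ j (φ i x) = φ i x := fun i j hij x => by
    ext s
    simp only [φ]
    split_ifs with h1 h2 <;> first | rfl | omega
  let L : ℕ → Set D := fun i => {x | φ i x = x}
  have hLclosed : ∀ i, IsClosed (L i) := by
    intro i
    have h := isClosed_of_polyFun
      ((fun s => fun x : ZariskiAffine σ => x.coord s - p.coord s) '' {s | ¬ (e s : ℕ) < i})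
      (by
        rintro _ ⟨s, -, rfl⟩
        exact (polyFun σ).sub_mem (coord_mem_polyFun s) (const_mem_polyFun (p.coord s)))
    convert h.preimage (continuous_subtype_val (p := (· ∈ D))) using 1
    ext x
    simp only [L, φ, ZariskiAffine.ext_iff, funext_iff, Set.mem_ofPred_eq, Set.forall_mem_image,
      Set.mem_preimage, sub_eq_zero]
    refine forall_congr' fun s => ?_
    by_cases h : (e s : ℕ) < i <;> simp [h, eq_comm]
  have hLirr : ∀ i, IsIrreducible (L i) := by
    intro i
    have hU : IsIrreducible (φ i ⁻¹' D) :=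
      ⟨⟨p, by simpa [hφp] using hp⟩,
        (PreirreducibleSpace.isPreirreducible_univ).open_subset (hD.preimage (hφ i))
          (Set.subset_univ _)⟩
    have : IrreducibleSpace (φ i ⁻¹' D) := Subtype.irreducibleSpace hU
    let ψ : φ i ⁻¹' D → D := fun x => ⟨φ i x, x.2⟩
    have hψ : Continuous ψ := ((hφ i).comp continuous_subtype_val).subtype_mk _
    have hr : L i = Set.range ψ := by
      ext x
      constructor
      · intro hx
        have hx' : φ i x = x := hx
        exact ⟨⟨x, by rw [Set.mem_preimage, hx']; exact x.2⟩, Subtype.ext hx'⟩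
      · rintro ⟨y, rfl⟩
        exact hφφ i i le_rfl y
    rw [hr, ← Set.image_univ]
    exact (IrreducibleSpace.isIrreducible_univ _).image ψ hψ.continuousOn
  have hLmono : ∀ i j, i ≤ j → L i ⊆ L j := by
    intro i j hij x hx
    have hx' : φ i x = x := hx
    change φ j x = x
    rw [← hx', hφφ i j hij]
  have hLlt : ∀ i j, i < j → j ≤ Nat.card σ → L i ⊂ L j := by
    intro i j hij hj
    refine ⟨hLmono i j hij.le, fun hsub => ?_⟩
    let s : σ := e.symm ⟨i, by omega⟩
    -- A general point of the larger subspace lies in `D` and differs from `p` in coordinate `s`.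
    obtain ⟨x, hxD, hxs⟩ := nonempty_preirreducible_inter (hD.preimage (hφ j))
      (isOpen_ne_zero ((polyFun σ).sub_mem (coord_mem_polyFun s) (const_mem_polyFun (p.coord s))))
      ⟨p, by simpa [hφp] using hp⟩ ⟨⟨fun t => p.coord t + 1⟩, by simp [Set.mem_ofPred_eq]⟩
    have h : φ i (φ j x) = φ j x := hsub (a := ⟨φ j x, hxD⟩) (hφφ j j le_rfl x)
    have h1 := congrFun (congrArg coord h) s
    have hs : (e s : ℕ) = i := by simp [s]
    simp only [φ, hs, lt_irrefl, if_false, hij, if_true] at h1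
    exact hxs (by simp [h1])
  let series : LTSeries (TopologicalSpace.IrreducibleCloseds D) :=
    { length := Nat.card σ
      toFun := fun i => ⟨L i, hLirr i, hLclosed i⟩
      step := fun i => hLlt i.castSucc i.succ (by simp) (by simp) }
  exact Order.LTSeries.length_le_krullDim series

end ZariskiAffine

/-! ### Multihomogeneous polynomials -/

namespace MultiProj

variable {ι : Type*} [DecidableEq ι] {E : ι → Type*}
  [∀ i, AddCommGroup (E i)] [∀ i, Module ℂ (E i)]

theorem isClosed_iff {S : Set (MultiProj E)} :
    IsClosed S ↔ ∃ F : Set (Poly E), (∀ f ∈ F, f.IsMultihomogeneous) ∧ S = zeroLocus F := by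
  rw [← isOpen_compl_iff]
  change Sᶜᶜ ∈ _ ↔ _
  rw [compl_compl]
  rfl

theorem Poly.value_smul_eq_zero_iff [Finite ι] {f : Poly E} (hf : f.IsMultihomogeneous)
    (c : ι → ℂˣ) (v : ∀ i, E i) : f.value (fun i => c i • v i) = 0 ↔ f.value v = 0 := by
  have := Fintype.ofFinite ι
  obtain ⟨m, hm⟩ := hf
  have key : f.value (fun i => c i • v i) = (∏ i, (c i : ℂ) ^ m i) * f.value v := by
    simp only [Poly.value, MvPolynomial.eval_eq, Finset.mul_sum]
    refine Finset.sum_congr rfl fun s hs => ?_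
    have hw := hm (MvPolynomial.mem_support_iff.1 hs)
    rw [Finsupp.weight_apply, Finsupp.sum] at hw
    have hc : ∏ i, (c i : ℂ) ^ m i = ∏ p ∈ s.support, (c p.1 : ℂ) ^ s p := by
      rw [← hw]
      simp only [Finset.sum_apply, Pi.smul_apply, ← Finset.prod_pow_eq_pow_sum]
      rw [Finset.prod_comm]
      refine Finset.prod_congr rfl fun p _ => ?_
      rw [Finset.prod_eq_single p.1]
      · simp
      · intro b _ hb
        simp [hb]
      · simp
    rw [hc, mul_left_comm, ← Finset.prod_mul_distrib]
    congr 1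
    refine Finset.prod_congr rfl fun p _ => ?_
    simp [Units.smul_def, mul_pow]
  rw [key, mul_eq_zero_iff_left]
  exact Finset.prod_ne_zero_iff.2 fun i _ => pow_ne_zero _ (c i).ne_zero

theorem isMultihomogeneous_X (p : Σ i, Module.Dual ℂ (E i)) :
    Poly.IsMultihomogeneous (MvPolynomial.X p : Poly E) :=
  ⟨_, MvPolynomial.isWeightedHomogeneous_X _ _ _⟩

/-- Homogenization: if linear forms `φ₀ i` take the value `1` on the vectors `v x i`, then every
polynomial in values of linear forms on the `v x i` is the value of a multihomogeneous polynomial.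
-/
theorem exists_isMultihomogeneous_value_eq [Finite ι] {X σ : Type*} (v : X → ∀ i, E i)
    (φ₀ : ∀ i, Module.Dual ℂ (E i)) (h₀ : ∀ x i, φ₀ i (v x i) = 1)
    (φ : σ → Σ i, Module.Dual ℂ (E i)) (f : MvPolynomial σ ℂ) :
    ∃ g : Poly E, g.IsMultihomogeneous ∧
      ∀ x, g.value (v x) = MvPolynomial.eval (fun s => (φ s).2 (v x (φ s).1)) f := by
  have := Fintype.ofFinite ι
  -- For the induction, the homogenization must exist in every large enough multidegree.
  suffices h : ∃ m₀ : ι → ℕ, ∀ m, m₀ ≤ m → ∃ g : Poly E,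
      MvPolynomial.IsWeightedHomogeneous
        (fun p : (Σ i, Module.Dual ℂ (E i)) => (Pi.single p.1 1 : ι → ℕ)) g m ∧
      ∀ x, g.value (v x) = MvPolynomial.eval (fun s => (φ s).2 (v x (φ s).1)) f by
    obtain ⟨m₀, h⟩ := h
    obtain ⟨g, hg, hv⟩ := h m₀ le_rfl
    exact ⟨g, ⟨m₀, hg⟩, hv⟩
  induction f using MvPolynomial.induction_on with
  | C a =>
    refine ⟨0, fun m _ => ⟨MvPolynomial.C a * ∏ i, MvPolynomial.X ⟨i, φ₀ i⟩ ^ m i, ?_, ?_⟩⟩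
    · refine MvPolynomial.IsWeightedHomogeneous.C_mul ?_ a
      have h := MvPolynomial.IsWeightedHomogeneous.prod Finset.univ
        (fun i => (MvPolynomial.X ⟨i, φ₀ i⟩ ^ m i : Poly E)) (fun i => m i • Pi.single i 1)
        (w := fun p : (Σ i, Module.Dual ℂ (E i)) => (Pi.single p.1 1 : ι → ℕ))
        (fun i _ => (MvPolynomial.isWeightedHomogeneous_X ℂ _ _).pow (m i))
      convert h using 1
      ext j
      simp [Finset.sum_apply, Pi.single_apply]
    · intro x
      simp [Poly.value, h₀]
  | add p q hp hq =>
    obtain ⟨m₁, h₁⟩ := hp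
    obtain ⟨m₂, h₂⟩ := hq
    refine ⟨m₁ ⊔ m₂, fun m hm => ?_⟩
    obtain ⟨g₁, hg₁, hv₁⟩ := h₁ m (le_sup_left.trans hm)
    obtain ⟨g₂, hg₂, hv₂⟩ := h₂ m (le_sup_right.trans hm)
    refine ⟨g₁ + g₂, hg₁.add hg₂, fun x => ?_⟩
    rw [map_add, ← hv₁, ← hv₂]
    simp [Poly.value]
  | mul_X p s hp =>
    obtain ⟨m₁, h₁⟩ := hp
    refine ⟨m₁ + Pi.single (φ s).1 1, fun m hm => ?_⟩
    obtain ⟨g, hg, hv⟩ := h₁ (m - Pi.single (φ s).1 1) (le_tsub_of_add_le_right hm)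
    refine ⟨g * MvPolynomial.X (φ s), ?_, fun x => ?_⟩
    · have h := hg.mul (MvPolynomial.isWeightedHomogeneous_X ℂ _ (φ s))
      rwa [tsub_add_cancel_of_le (le_of_add_le_right hm)] at h
    · rw [map_mul, ← hv]
      simp [Poly.value]

end MultiProj

/-! ### Plücker coordinates and affine charts of a Grassmannian -/

section Charts

variable {V : Type*} [AddCommGroup V] [Module ℂ V]

/-- The vectors `p_j + ∑ k, A k j • q_k`, where `p` and `q` are the two parts of the basis `b`. They
span the graph of the linear map `span p → span q` with matrix `A`. -/
noncomputable def graphVec {d e : ℕ} (b : Module.Basis (Fin d ⊕ Fin e) ℂ V)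
    (A : Fin e → Fin d → ℂ) (j : Fin d) : V :=
  b (Sum.inl j) + ∑ k, A k j • b (Sum.inr k)

section

variable {d e : ℕ} (b : Module.Basis (Fin d ⊕ Fin e) ℂ V) (A : Fin e → Fin d → ℂ)

theorem coord_inl_graphVec (i j : Fin d) :
    b.coord (Sum.inl i) (graphVec b A j) = if i = j then 1 else 0 := by
  simp [graphVec, Finsupp.single_apply, eq_comm]

theorem coord_inr_graphVec (k : Fin e) (j : Fin d) :
    b.coord (Sum.inr k) (graphVec b A j) = A k j := by
  simp [graphVec, Finsupp.single_apply]

theorem linearIndependent_graphVec : LinearIndependent ℂ (graphVec b A) := by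
  rw [Fintype.linearIndependent_iff]
  intro g hg i
  have h := congrArg (b.coord (Sum.inl i)) hg
  simp only [map_sum, map_smul, coord_inl_graphVec, map_zero, smul_eq_mul] at h
  simpa using h

theorem coord_inr_of_mem_span_graphVec {v : V}
    (hv : v ∈ Submodule.span ℂ (Set.range (graphVec b A))) (k : Fin e) :
    b.coord (Sum.inr k) v = ∑ j, A k j * b.coord (Sum.inl j) v := by
  induction hv using Submodule.span_induction with
  | mem x hx =>
    obtain ⟨j, rfl⟩ := hx
    simp only [coord_inr_graphVec, coord_inl_graphVec]
    simp
  | zero => simp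
  | add x y _ _ hx hy => simp only [map_add, hx, hy, mul_add, Finset.sum_add_distrib]
  | smul a x _ hx =>
    simp only [map_smul, hx, smul_eq_mul, Finset.mul_sum]
    exact Finset.sum_congr rfl fun j _ => by ring

/-- The graph of the linear map with matrix `A`, as a point of the Grassmannian. -/
noncomputable def graphPoint : Gr V d :=
  ⟨Submodule.span ℂ (Set.range (graphVec b A)), by
    rw [finrank_span_eq_card (linearIndependent_graphVec b A), Fintype.card_fin]⟩

theorem graphVec_mem (j : Fin d) : graphVec b A j ∈ (graphPoint b A).1 :=
  Submodule.subset_span ⟨j, rfl⟩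

end

/-- The linear form on the exterior power given by a family `f` of linear forms:
`v₁ ∧ ⋯ ∧ v_d ↦ det (f j (v i))`. -/
noncomputable def wedgeForm {d : ℕ} (f : Fin d → Module.Dual ℂ V) : Module.Dual ℂ (⋀[ℂ]^d V) :=
  exteriorPower.pairingDual ℂ V d (exteriorPower.ιMulti ℂ d f)

theorem wedgeForm_ιMulti {d : ℕ} (f : Fin d → Module.Dual ℂ V) (v : Fin d → V) :
    wedgeForm f (exteriorPower.ιMulti ℂ d v) = (Matrix.of fun i j => f j (v i)).det :=
  exteriorPower.pairingDual_ιMulti_ιMulti f v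

theorem wedgeForm_coord_graphVec {d e : ℕ} (b : Module.Basis (Fin d ⊕ Fin e) ℂ V)
    (A : Fin e → Fin d → ℂ) :
    wedgeForm (fun j => b.coord (Sum.inl j)) (exteriorPower.ιMulti ℂ d (graphVec b A)) = 1 := by
  rw [wedgeForm_ιMulti, ← Matrix.det_one (n := Fin d)]
  congr 1
  ext i j
  rw [Matrix.of_apply, coord_inl_graphVec, Matrix.one_apply]
  simp [eq_comm]

/-- The entries of `A` are Plücker coordinates of the graph. -/
theorem wedgeForm_update_graphVec {d e : ℕ} (b : Module.Basis (Fin d ⊕ Fin e) ℂ V)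
    (A : Fin e → Fin d → ℂ) (k : Fin e) (j : Fin d) :
    wedgeForm (Function.update (fun j => b.coord (Sum.inl j)) j (b.coord (Sum.inr k)))
      (exteriorPower.ιMulti ℂ d (graphVec b A)) = A k j := by
  have h : (Matrix.of fun i l => (Function.update (fun j => b.coord (Sum.inl j)) j
      (b.coord (Sum.inr k))) l (graphVec b A i)) =
      (1 : Matrix (Fin d) (Fin d) ℂ).updateCol j (A k) := by
    ext i l
    rw [Matrix.of_apply, Matrix.updateCol_apply]
    by_cases hl : l = j
    · subst hl
      simp only [Function.update_self, coord_inr_graphVec, if_true]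
    · simp only [Function.update_of_ne hl, coord_inl_graphVec, hl, if_false, Matrix.one_apply]
      simp [eq_comm]
  rw [wedgeForm_ιMulti, h, ← Matrix.cramer_apply, Matrix.cramer_one]
  rfl

variable [FiniteDimensional ℂ V]

theorem graphPoint_eq {d e : ℕ} (b : Module.Basis (Fin d ⊕ Fin e) ℂ V) (A : Fin e → Fin d → ℂ)
    {W : Gr V d} (h : ∀ j, graphVec b A j ∈ W.1) : graphPoint b A = W := by
  refine Subtype.ext (Submodule.eq_of_le_of_finrank_eq ?_ ?_)
  · rw [graphPoint, Submodule.span_le]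
    rintro _ ⟨j, rfl⟩
    exact h j
  · rw [(graphPoint b A).2, W.2]

/-- Any two bases of a subspace have proportional wedge products. -/
theorem Gr.exists_smul_eq_plucker_rep {d : ℕ} (W : Gr V d) {w : Fin d → V} (hw : ∀ j, w j ∈ W.1)
    (hli : LinearIndependent ℂ w) :
    ∃ c : ℂˣ, W.plucker.rep = c • exteriorPower.ιMulti ℂ d w := by
  let w' : Fin d → W.1 := fun j => ⟨w j, hw j⟩
  have hli' : LinearIndependent ℂ w' := LinearIndependent.of_comp W.1.subtype hli
  have hcard : Fintype.card (Fin d) = Module.finrank ℂ W.1 := by rw [Fintype.card_fin, W.2]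
  have hunit : IsUnit (W.basis.det w') :=
    W.basis.is_basis_iff_det.1 ⟨hli', (hli'.span_eq_top_of_card_eq_finrank' hcard)⟩
  have hmap : (exteriorPower.ιMulti ℂ d).compLinearMap W.1.subtype =
      (LinearMap.toSpanSingleton ℂ _
        (exteriorPower.ιMulti ℂ d fun j => (W.basis j : V))).compAlternatingMap W.basis.det := by
    refine Module.Basis.ext_alternating W.basis fun i hi => ?_
    let σ : Equiv.Perm (Fin d) := Equiv.ofBijective i (Finite.injective_iff_bijective.1 hi)
    have h1 := AlternatingMap.map_perm
      ((exteriorPower.ιMulti ℂ d).compLinearMap W.1.subtype) W.basis σ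
    have h2 := AlternatingMap.map_perm W.basis.det W.basis σ
    change ((exteriorPower.ιMulti ℂ d).compLinearMap W.1.subtype) (W.basis ∘ σ) =
      W.basis.det (W.basis ∘ σ) • _
    rw [h1, h2, W.basis.det_self]
    rcases Int.units_eq_one_or (Equiv.Perm.sign σ) with h | h
    · simp [h]
    · simp [h]
      rfl
  have hwedge : exteriorPower.ιMulti ℂ d w =
      W.basis.det w' • exteriorPower.ιMulti ℂ d fun j => (W.basis j : V) :=
    congrArg (fun f => f w') hmap
  obtain ⟨a, ha⟩ := Projectivization.exists_smul_eq_mk_rep ℂ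
    (exteriorPower.ιMulti ℂ d (fun j => (W.basis j : V))) W.wedge_basis_ne_zero
  refine ⟨a * hunit.unit⁻¹, ?_⟩
  rw [hwedge, mul_smul]
  change (Projectivization.mk ℂ _ _).rep = _
  rw [← ha]
  congr 1
  rw [eq_inv_smul_iff, Units.smul_def, hunit.unit_spec]

/-- A subspace lies in the chart at `b` if its projection to the first part of `b` is bijective. -/
theorem exists_graphPoint_eq {d e : ℕ} (b : Module.Basis (Fin d ⊕ Fin e) ℂ V) (W : Gr V d)
    (hW : wedgeForm (fun j => b.coord (Sum.inl j))
      (exteriorPower.ιMulti ℂ d fun j => (W.basis j : V)) ≠ 0) :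
    ∃ A, graphPoint b A = W := by
  rw [wedgeForm_ιMulti] at hW
  set B : Matrix (Fin d) (Fin d) ℂ :=
    Matrix.of fun i j => b.coord (Sum.inl j) (W.basis i : V) with hB
  have hinv : B⁻¹ * B = 1 := Matrix.nonsing_inv_mul _ (isUnit_iff_ne_zero.2 hW)
  let w : Fin d → V := fun j => ∑ i, B⁻¹ j i • (W.basis i : V)
  have hw : ∀ j, w j ∈ W.1 := fun j =>
    W.1.sum_mem fun i _ => W.1.smul_mem _ (W.basis i).2
  have hwl : ∀ i j, b.coord (Sum.inl i) (w j) = if i = j then 1 else 0 := by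
    intro i j
    have h := congrFun (congrFun hinv j) i
    rw [Matrix.mul_apply, Matrix.one_apply] at h
    simp only [w, map_sum, map_smul, smul_eq_mul]
    simpa [hB, eq_comm] using h
  refine ⟨fun k j => b.coord (Sum.inr k) (w j), graphPoint_eq b _ fun j => ?_⟩
  convert hw j
  refine b.ext_elem fun x => ?_
  rcases x with i | k
  · exact (coord_inl_graphVec b _ i j).trans (hwl i j).symm
  · exact coord_inr_graphVec b _ k j

theorem Gr.wedge_basis_form_ne_zero {d : ℕ} (W : Gr V d) (φ : Module.Dual ℂ (⋀[ℂ]^d V))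
    (hφ : φ W.plucker.rep ≠ 0) : φ (exteriorPower.ιMulti ℂ d fun j => (W.basis j : V)) ≠ 0 := by
  have hli : LinearIndependent ℂ (fun j => (W.basis j : V)) :=
    W.basis.linearIndependent.map' W.1.subtype W.1.ker_subtype
  obtain ⟨c, hc⟩ := W.exists_smul_eq_plucker_rep (w := fun j => (W.basis j : V))
    (fun j => (W.basis j).2) hli
  intro h
  exact hφ (by rw [hc, Units.smul_def, map_smul, h, smul_zero])

theorem wedgeForm_plucker_graphPoint_ne_zero {d e : ℕ} (b : Module.Basis (Fin d ⊕ Fin e) ℂ V)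
    (A : Fin e → Fin d → ℂ) :
    wedgeForm (fun j => b.coord (Sum.inl j)) (graphPoint b A).plucker.rep ≠ 0 := by
  obtain ⟨c, hc⟩ := (graphPoint b A).exists_smul_eq_plucker_rep (graphVec_mem b A)
    (linearIndependent_graphVec b A)
  intro h
  rw [hc, Units.smul_def, map_smul, wedgeForm_coord_graphVec] at h
  simp at h

/-- The chart at `b` consists of the subspaces with a nonzero Plücker coordinate. -/
theorem exists_graphPoint_eq_iff {d e : ℕ} (b : Module.Basis (Fin d ⊕ Fin e) ℂ V) (W : Gr V d) :
    (∃ A, graphPoint b A = W) ↔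
      wedgeForm (fun j => b.coord (Sum.inl j)) W.plucker.rep ≠ 0 := by
  constructor
  · intro ⟨A, hA⟩
    rw [← hA]
    exact wedgeForm_plucker_graphPoint_ne_zero b A
  · exact fun h => exists_graphPoint_eq b W (W.wedge_basis_form_ne_zero _ h)

/-- Every point of the Grassmannian is the origin of a chart. -/
theorem Gr.exists_graphPoint_zero_eq {d e : ℕ} (hde : Module.finrank ℂ V = d + e) (W : Gr V d) :
    ∃ b : Module.Basis (Fin d ⊕ Fin e) ℂ V, graphPoint b 0 = W := by
  obtain ⟨Q, hQ⟩ := W.1.exists_isCompl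
  have hQe : Module.finrank ℂ Q = e := by
    have h := Submodule.finrank_add_eq_of_isCompl hQ
    rw [W.2] at h
    omega
  let c := Module.finBasisOfFinrankEq ℂ Q hQe
  refine ⟨(W.basis.prod c).map (Submodule.prodEquivOfIsCompl _ _ hQ), ?_⟩
  refine graphPoint_eq _ _ fun j => ?_
  simp [graphVec]

end Charts

/-! ### Affine charts of a product of Grassmannians -/

section ProductCharts

open ZariskiAffine

variable {V : Type*} [AddCommGroup V] [Module ℂ V] {K : ℕ} {d e : Fin K → ℕ}

/-- The affine chart of `∏ i, G(d i, V)` given by bases `b i` of `V`: a family of matrices is mapped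
to the family of graphs. -/
noncomputable def grChart (b : ∀ i, Module.Basis (Fin (d i) ⊕ Fin (e i)) ℂ V)
    (x : ZariskiAffine (Σ i, Fin (e i) × Fin (d i))) : GrProd V d :=
  fun i => graphPoint (b i) fun k j => x.coord ⟨i, k, j⟩

/-- The value of a multilinear map on vectors with polynomial coefficients is polynomial. -/
theorem multilinear_mem_polyFun {σ κ W : Type*} [Fintype κ] [AddCommGroup W] [Module ℂ W] {n : ℕ}
    (f : MultilinearMap ℂ (fun _ : Fin n => W) ℂ) (v : κ → W)
    (c : Fin n → κ → ZariskiAffine σ → ℂ) (hc : ∀ j k, c j k ∈ polyFun σ) :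
    (fun x => f fun j => ∑ k, c j k x • v k) ∈ polyFun σ := by
  classical
  have h : (fun x => f fun j => ∑ k, c j k x • v k) =
      ∑ r : Fin n → κ, (∏ j, c j (r j)) * fun _ => f fun j => v (r j) := by
    funext x
    rw [MultilinearMap.map_sum]
    simp only [MultilinearMap.map_smul_univ, Finset.sum_apply, Pi.mul_apply, Finset.prod_apply,
      smul_eq_mul]
  rw [h]
  exact (polyFun σ).sum_mem fun r _ =>
    (polyFun σ).mul_mem ((polyFun σ).prod_mem fun j _ => hc j _) (const_mem_polyFun _)

theorem wedge_graphVec_mem_polyFun (b : ∀ i, Module.Basis (Fin (d i) ⊕ Fin (e i)) ℂ V) (i : Fin K)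
    (φ : Module.Dual ℂ (⋀[ℂ]^(d i) V)) :
    (fun x : ZariskiAffine (Σ i, Fin (e i) × Fin (d i)) =>
      φ (exteriorPower.ιMulti ℂ (d i) (graphVec (b i) fun k j => x.coord ⟨i, k, j⟩))) ∈
      polyFun _ := by
  have h := multilinear_mem_polyFun
    (φ.compAlternatingMap (exteriorPower.ιMulti ℂ (d i))).toMultilinearMap (b i)
    (fun j => Sum.elim (fun l _ => if l = j then 1 else 0)
      fun k x => x.coord (⟨i, k, j⟩ : Σ i, Fin (e i) × Fin (d i)))
    (by
      rintro j (l | k)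
      · exact const_mem_polyFun _
      · exact coord_mem_polyFun (⟨i, k, j⟩ : Σ i, Fin (e i) × Fin (d i)))
  convert h using 2 with x
  change φ (exteriorPower.ιMulti ℂ (d i) _) = φ (exteriorPower.ιMulti ℂ (d i) _)
  congr 2
  funext j
  simp [graphVec]

theorem injective_grChart (b : ∀ i, Module.Basis (Fin (d i) ⊕ Fin (e i)) ℂ V) :
    Function.Injective (grChart b) := by
  intro x y hxy
  ext ⟨i, k, j⟩
  have hmem : graphVec (b i) (fun k j => y.coord ⟨i, k, j⟩) j ∈
      (graphPoint (b i) fun k j => x.coord ⟨i, k, j⟩).1 := by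
    rw [show graphPoint (b i) (fun k j => x.coord ⟨i, k, j⟩) = graphPoint (b i) _ from
      congrFun hxy i]
    exact graphVec_mem (b i) _ j
  have h := coord_inr_of_mem_span_graphVec (b i) _ hmem k
  simp only [coord_inr_graphVec, coord_inl_graphVec] at h
  simpa using h.symm

variable [FiniteDimensional ℂ V]

/-- The vanishing of a multihomogeneous polynomial at a point of a product of Grassmannians can be
tested on any bases of the subspaces. -/
theorem GrProd.value_plucker_eq_zero_iff (W : GrProd V d) (w : ∀ i, Fin (d i) → V)
    (hw : ∀ i j, w i j ∈ (W i).1) (hli : ∀ i, LinearIndependent ℂ (w i))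
    {f : MultiProj.Poly fun i => ⋀[ℂ]^(d i) V} (hf : f.IsMultihomogeneous) :
    f.value (fun i => (W.plucker i).rep) = 0 ↔
      f.value (fun i => exteriorPower.ιMulti ℂ (d i) (w i)) = 0 := by
  choose c hc using fun i => (W i).exists_smul_eq_plucker_rep (hw i) (hli i)
  have h : (fun i => (W.plucker i).rep) = fun i => c i • exteriorPower.ιMulti ℂ (d i) (w i) :=
    funext hc
  rw [h]
  exact MultiProj.Poly.value_smul_eq_zero_iff hf c _

variable (b : ∀ i, Module.Basis (Fin (d i) ⊕ Fin (e i)) ℂ V)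

theorem value_plucker_grChart_eq_zero_iff (x : ZariskiAffine (Σ i, Fin (e i) × Fin (d i)))
    {f : MultiProj.Poly fun i => ⋀[ℂ]^(d i) V} (hf : f.IsMultihomogeneous) :
    f.value (fun i => ((grChart b x).plucker i).rep) = 0 ↔
      f.value (fun i => exteriorPower.ιMulti ℂ (d i)
        (graphVec (b i) fun k j => x.coord ⟨i, k, j⟩)) = 0 :=
  GrProd.value_plucker_eq_zero_iff _ _ (fun i j => graphVec_mem (b i) _ j)
    (fun i => linearIndependent_graphVec (b i) _) hf

theorem isInducing_grChart : Topology.IsInducing (grChart b) := by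
  have hind : Topology.IsInducing (GrProd.plucker : GrProd V d → _) := ⟨rfl⟩
  rw [← hind.of_comp_iff]
  refine ⟨TopologicalSpace.ext_isClosed fun S => ?_⟩
  constructor
  · intro hS
    obtain ⟨F, rfl⟩ := ZariskiAffine.isClosed_iff.1 hS
    choose H hH hHv using fun f => MultiProj.exists_isMultihomogeneous_value_eq
      (fun (x : ZariskiAffine (Σ i, Fin (e i) × Fin (d i))) i =>
        exteriorPower.ιMulti ℂ (d i) (graphVec (b i) fun k j => x.coord ⟨i, k, j⟩))
      (fun i => wedgeForm fun j => (b i).coord (Sum.inl j))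
      (fun x i => wedgeForm_coord_graphVec (b i) _)
      (fun s : Σ i, Fin (e i) × Fin (d i) => ⟨s.1, wedgeForm (Function.update
        (fun j => (b s.1).coord (Sum.inl j)) s.2.2 ((b s.1).coord (Sum.inr s.2.1)))⟩) f
    refine isClosed_induced_iff.2 ⟨MultiProj.zeroLocus (H '' F),
      MultiProj.isClosed_iff.2 ⟨_, ?_, rfl⟩, ?_⟩
    · rintro _ ⟨f, -, rfl⟩
      exact hH f
    · ext x
      simp only [MultiProj.zeroLocus, Set.mem_preimage, Set.mem_ofPred_eq, Set.forall_mem_image,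
        Function.comp_apply]
      refine forall₂_congr fun f _ => ?_
      rw [value_plucker_grChart_eq_zero_iff b x (hH f), hHv]
      simp only [wedgeForm_update_graphVec]
  · intro hS
    obtain ⟨T, hT, rfl⟩ := isClosed_induced_iff.1 hS
    obtain ⟨F, hF, rfl⟩ := MultiProj.isClosed_iff.1 hT
    have h := isClosed_of_polyFun
      ((fun f : MultiProj.Poly fun i => ⋀[ℂ]^(d i) V =>
        fun x : ZariskiAffine (Σ i, Fin (e i) × Fin (d i)) =>
          f.value fun i => exteriorPower.ιMulti ℂ (d i)
            (graphVec (b i) fun k j => x.coord ⟨i, k, j⟩)) '' F)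
      (by
        rintro _ ⟨f, -, rfl⟩
        exact eval_comp_mem_polyFun f _ fun p => wedge_graphVec_mem_polyFun b p.1 p.2)
    convert h using 1
    ext x
    simp only [MultiProj.zeroLocus, Set.mem_preimage, Set.mem_ofPred_eq, Set.forall_mem_image,
      Function.comp_apply]
    exact forall₂_congr fun f hf => value_plucker_grChart_eq_zero_iff b x (hF f hf)

theorem GrProd.isOpen_plucker_ne_zero (i : Fin K) (φ : Module.Dual ℂ (⋀[ℂ]^(d i) V)) :
    IsOpen {W : GrProd V d | φ (W i).plucker.rep ≠ 0} := by
  let P : MultiProj.Poly fun i => ⋀[ℂ]^(d i) V := MvPolynomial.X ⟨i, φ⟩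
  have hcl : IsClosed (MultiProj.zeroLocus {P}) :=
    MultiProj.isClosed_iff.2 ⟨{P}, fun f hf => hf ▸ MultiProj.isMultihomogeneous_X _, rfl⟩
  have h := (hcl.preimage (f := (GrProd.plucker : GrProd V d → _)) continuous_induced_dom)
  have hs : {W : GrProd V d | φ (W i).plucker.rep ≠ 0} =
      (GrProd.plucker ⁻¹' MultiProj.zeroLocus {P})ᶜ := by
    refine Set.ext fun W => ?_
    simp only [Set.mem_ofPred_eq, Set.mem_compl_iff, Set.mem_preimage, MultiProj.zeroLocus,
      Set.mem_singleton_iff, forall_eq, P, MultiProj.Poly.value, MvPolynomial.eval_X]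
    rfl
  rw [hs]
  exact h.isOpen_compl

theorem isOpen_range_grChart : IsOpen (Set.range (grChart b)) := by
  -- The range is where the first Plücker coordinate does not vanish on any factor.
  let φ : ∀ i, Module.Dual ℂ (⋀[ℂ]^(d i) V) := fun i => wedgeForm fun j => (b i).coord (Sum.inl j)
  have hr : Set.range (grChart b) = ⋂ i, {W : GrProd V d | φ i (W i).plucker.rep ≠ 0} := by
    refine Set.ext fun W => ?_
    simp only [Set.mem_range, Set.mem_iInter, Set.mem_ofPred_eq, φ, ← exists_graphPoint_eq_iff]
    constructor
    · rintro ⟨x, rfl⟩ i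
      exact ⟨_, rfl⟩
    · intro h
      choose A hA using h
      exact ⟨⟨fun s => A s.1 s.2.1 s.2.2⟩, funext hA⟩
  rw [hr]
  exact isOpen_iInter_of_finite fun i => GrProd.isOpen_plucker_ne_zero i (φ i)

theorem isOpenEmbedding_grChart : Topology.IsOpenEmbedding (grChart b) :=
  ⟨⟨isInducing_grChart b, injective_grChart b⟩, isOpen_range_grChart b⟩

theorem GrProd.exists_grChart_zero_eq (hde : ∀ i, Module.finrank ℂ V = d i + e i)
    (W : GrProd V d) :
    ∃ b : ∀ i, Module.Basis (Fin (d i) ⊕ Fin (e i)) ℂ V, grChart b ⟨0⟩ = W := by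
  choose b hb using fun i => (W i).exists_graphPoint_zero_eq (hde i)
  exact ⟨b, funext hb⟩

end ProductCharts

/-- The dimension of a space is local for covers by open embeddings. -/
theorem topologicalKrullDim_le_of_isOpenEmbedding {X Y : Type*} [TopologicalSpace X]
    [TopologicalSpace Y] {n : WithBot ℕ∞} (hY : topologicalKrullDim Y ≤ n)
    (h : ∀ x : X, ∃ f : Y → X, Topology.IsOpenEmbedding f ∧ x ∈ Set.range f) :
    topologicalKrullDim X ≤ n := by
  rw [topologicalKrullDim, Order.krullDim_eq_iSup_coheight]
  refine iSup_le fun Z => ?_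
  obtain ⟨x, hx⟩ := Z.isIrreducible.nonempty
  obtain ⟨f, hf, y, rfl⟩ := h x
  let e := TopologicalSpace.IrreducibleCloseds.orderIsoOfIsOpenEmbedding f hf
  let Z' := e.symm ⟨Z, ⟨y, hx⟩⟩
  have hZ : TopologicalSpace.IrreducibleCloseds.map f hf.continuous Z' = Z :=
    congrArg Subtype.val (e.apply_symm_apply ⟨Z, ⟨y, hx⟩⟩)
  rw [← hZ, hf.coheight_map]
  exact (Order.coheight_le_krullDim Z').trans hY

/-- A product of Grassmannians has dimension at most `∑ i, d i (N - d i)`. -/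
theorem GrProd.topologicalKrullDim_le {V : Type*} [AddCommGroup V] [Module ℂ V]
    [FiniteDimensional ℂ V] {K : ℕ} {d e : Fin K → ℕ}
    (hde : ∀ i, Module.finrank ℂ V = d i + e i) :
    topologicalKrullDim (GrProd V d) ≤ ((∑ i, e i * d i : ℕ) : WithBot ℕ∞) := by
  refine topologicalKrullDim_le_of_isOpenEmbedding
    (Y := ZariskiAffine (Σ i, Fin (e i) × Fin (d i))) ?_ fun W => ?_
  · refine ZariskiAffine.topologicalKrullDim_le.trans (le_of_eq ?_)
    simp
  · obtain ⟨b, hb⟩ := W.exists_grChart_zero_eq hde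
    exact ⟨grChart b, isOpenEmbedding_grChart b, _, hb⟩

/-! ### Triples of subspaces with zero intersection -/

section Triples

open Module Submodule

variable {V : Type*} [AddCommGroup V] [Module ℂ V]

theorem exists_triple_inf_eq_bot [FiniteDimensional ℂ V] {m : ℕ} (hV : finrank ℂ V = 3 * m) :
    ∃ W : GrProd V (fun _ : Fin 3 => 2 * m), ⨅ i, (W i).1 = ⊥ := by
  have hV' : finrank ℂ V = finrank ℂ (Fin 3 → Fin m → ℂ) := by
    rw [hV, finrank_pi_fintype]
    simp
  let e : V ≃ₗ[ℂ] (Fin 3 → Fin m → ℂ) := LinearEquiv.ofFinrankEq _ _ hV'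
  -- The `i`-th subspace is the kernel of the `i`-th block of coordinates.
  let p : Fin 3 → V →ₗ[ℂ] (Fin m → ℂ) := fun i => LinearMap.proj i ∘ₗ e.toLinearMap
  have hp : ∀ i, Function.Surjective (p i) := fun i =>
    (Function.surjective_eval i).comp e.surjective
  refine ⟨fun i => ⟨LinearMap.ker (p i), ?_⟩, ?_⟩
  · have h := (p i).finrank_range_add_finrank_ker
    rw [LinearMap.range_eq_top.2 (hp i), finrank_top, finrank_fin_fun, hV] at h
    change finrank ℂ (LinearMap.ker (p i)) = 2 * m
    omega
  · rw [eq_bot_iff]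
    intro v hv
    rw [Submodule.mem_iInf] at hv
    exact (Submodule.mem_bot ℂ).2 (e.map_eq_zero_iff.1 (funext fun i => hv i))

/-- Three subspaces of dimension `2m` of a space of dimension `3m` form a feasible strategy as soon
as their intersection is zero: this forces the dimensions of all sums and intersections. -/
theorem isFeasibleStrategy_of_iInf_eq_bot [FiniteDimensional ℂ V] {m : ℕ}
    (hV : finrank ℂ V = 3 * m) (W : Fin 3 → Submodule ℂ V) (hW : ∀ i, finrank ℂ (W i) = 2 * m)
    (hbot : ⨅ i, W i = ⊥) : IsFeasibleStrategy (fun _ : Fin 3 => 2 * m) W := by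
  -- Each intersection below avoids the third subspace, while all the others lie in it. This gives
  -- the independence of the intersections without any dimension count.
  have hdis : ∀ i j k : Fin 3, i ≠ j → i ≠ k → j ≠ k → Disjoint (W i ⊓ W j) (W k) := by
    intro i j k hij hik hjk
    rw [Submodule.disjoint_def]
    rintro v ⟨hi, hj⟩ hk
    rw [← Submodule.mem_bot ℂ, ← hbot, Submodule.mem_iInf]
    intro l
    obtain rfl | rfl | rfl : l = i ∨ l = j ∨ l = k := by omega
    exacts [hi, hj, hk]
  have hthird : ∀ i j : Fin 3, i ≠ j → ∃ k, i ≠ k ∧ j ≠ k := by decide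
  have hle : ∀ i j, m ≤ finrank ℂ ↥(W i ⊓ W j) := by
    intro i j
    have h1 := Submodule.finrank_sup_add_finrank_inf_eq (W i) (W j)
    have h2 := Submodule.finrank_le (W i ⊔ W j)
    rw [hW, hW] at h1
    omega
  have hsup : ∀ i j k : Fin 3, i ≠ j → i ≠ k → j ≠ k → (W i ⊓ W j) ⊔ (W i ⊓ W k) = W i := by
    intro i j k hij hik hjk
    refine Submodule.eq_of_le_of_finrank_le (sup_le inf_le_left inf_le_left) ?_
    have h1 := Submodule.finrank_sup_add_finrank_inf_eq (W i ⊓ W j) (W i ⊓ W k)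
    rw [((hdis i j k hij hik hjk).mono_right inf_le_right).eq_bot, finrank_bot] at h1
    have h2 := hle i j
    have h3 := hle i k
    rw [hW]
    omega
  refine ⟨hW, fun i => ⟨?_, ?_⟩, ⟨?_, ?_⟩⟩
  · rintro ⟨j, hj⟩
    obtain ⟨k, hik, hjk⟩ := hthird i j hj.symm
    refine (hdis i j k hj.symm hik hjk).mono_right (iSup₂_le ?_)
    rintro ⟨l, hl⟩ hne
    obtain rfl : l = k := by
      have : l ≠ j := fun h => hne (Subtype.ext h)
      omega
    exact inf_le_right
  · refine le_antisymm (iSup_le fun j => inf_le_left) ?_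
    obtain ⟨j, hij⟩ : ∃ j : Fin 3, i ≠ j := (exists_ne i).imp fun _ => Ne.symm
    obtain ⟨k, hik, hjk⟩ := hthird i j hij
    refine (hsup i j k hij hik hjk).ge.trans (sup_le ?_ ?_)
    · exact le_iSup (fun j : {j : Fin 3 // j ≠ i} => W i ⊓ W j.1) ⟨j, hij.symm⟩
    · exact le_iSup (fun j : {j : Fin 3 // j ≠ i} => W i ⊓ W j.1) ⟨k, hik.symm⟩
  · rintro ⟨⟨i, j⟩, hij⟩
    obtain ⟨k, hik, hjk⟩ := hthird i j (ne_of_lt hij)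
    refine (hdis i j k (ne_of_lt hij) hik hjk).mono_right (iSup₂_le ?_)
    rintro ⟨⟨a, b⟩, hab⟩ hne
    have hne' : ¬ (a = i ∧ b = j) := fun h => hne (Subtype.ext (Prod.ext h.1 h.2))
    have hab' : a < b := hab
    have hij' : i < j := hij
    obtain rfl | rfl : a = k ∨ b = k := by omega
    · exact inf_le_left
    · exact inf_le_right
  · have hle2 : (W 0 ⊔ (W 1 ⊓ W 2)) ≤
        ⨆ p : {p : Fin 3 × Fin 3 // p.1 < p.2}, W p.1.1 ⊓ W p.1.2 := by
      rw [← hsup 0 1 2 (by decide) (by decide) (by decide)]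
      exact sup_le (sup_le
        (le_iSup (fun p : {p : Fin 3 × Fin 3 // p.1 < p.2} => W p.1.1 ⊓ W p.1.2)
          ⟨(0, 1), by decide⟩)
        (le_iSup (fun p : {p : Fin 3 × Fin 3 // p.1 < p.2} => W p.1.1 ⊓ W p.1.2)
          ⟨(0, 2), by decide⟩))
        (le_iSup (fun p : {p : Fin 3 × Fin 3 // p.1 < p.2} => W p.1.1 ⊓ W p.1.2)
          ⟨(1, 2), by decide⟩)
    refine top_le_iff.1 (le_trans (top_le_iff.2 ?_) hle2)
    refine Submodule.eq_top_of_finrank_eq (le_antisymm (Submodule.finrank_le _) ?_)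
    have h1 := Submodule.finrank_sup_add_finrank_inf_eq (W 0) (W 1 ⊓ W 2)
    rw [(hdis 1 2 0 (by decide) (by decide) (by decide)).symm.eq_bot, finrank_bot, hW] at h1
    have h2 := hle 1 2
    omega

/-- The intersection of graphs is the kernel of a square matrix with polynomial entries when the
codimensions add up to `dim V`. Hence its vanishing is an open condition. -/
theorem exists_polyFun_iInf_grChart_eq_bot [FiniteDimensional ℂ V] {K : ℕ} {d e : Fin K → ℕ}
    (hV : finrank ℂ V = ∑ i, e i) (b : ∀ i, Basis (Fin (d i) ⊕ Fin (e i)) ℂ V) :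
    ∃ g ∈ ZariskiAffine.polyFun (Σ i, Fin (e i) × Fin (d i)),
      (∀ x, g x ≠ 0 → ⨅ i, (grChart b x i).1 = ⊥) ∧
      (⨅ i, (grChart b ⟨0⟩ i).1 = ⊥ → g ⟨0⟩ ≠ 0) := by
  let c : Basis (Σ i, Fin (e i)) ℂ V :=
    (finBasisOfFinrankEq ℂ V (n := Fintype.card (Σ i, Fin (e i))) (by simp [hV])).reindex
      (Fintype.equivFin _).symm
  -- The equations of the graphs.
  let L : ZariskiAffine (Σ i, Fin (e i) × Fin (d i)) → V →ₗ[ℂ] ((Σ i, Fin (e i)) → ℂ) :=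
    fun x => LinearMap.pi fun p => (b p.1).coord (Sum.inr p.2) -
      ∑ j, x.coord ⟨p.1, p.2, j⟩ • (b p.1).coord (Sum.inl j)
  have hL : ∀ x v p, L x v p = (b p.1).coord (Sum.inr p.2) v -
      ∑ j, x.coord ⟨p.1, p.2, j⟩ * (b p.1).coord (Sum.inl j) v := by
    intro x v p
    simp [L]
  let T : ZariskiAffine (Σ i, Fin (e i) × Fin (d i)) →
      Matrix (Σ i, Fin (e i)) (Σ i, Fin (e i)) ℂ := fun x => Matrix.of fun p q => L x (c q) p
  have hT : ∀ x v, (T x).mulVec (c.equivFun v) = L x v := by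
    intro x v
    funext p
    conv_rhs => rw [← c.sum_equivFun v, map_sum, Finset.sum_apply]
    simp [T, Matrix.mulVec, dotProduct, mul_comm]
  refine ⟨fun x => (T x).det, ?_, ?_, ?_⟩
  · have h : (fun x => (T x).det) = ∑ s : Equiv.Perm (Σ i, Fin (e i)),
        (fun _ => ((Equiv.Perm.sign s : ℤ) : ℂ)) * ∏ q, fun x => T x (s q) q := by
      funext x
      simp [Matrix.det_apply', Finset.sum_apply, Finset.prod_apply]
    rw [h]
    refine Subalgebra.sum_mem _ fun s _ => Subalgebra.mul_mem _
      (ZariskiAffine.const_mem_polyFun _) (Subalgebra.prod_mem _ fun q _ => ?_)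
    simp only [T, Matrix.of_apply, hL]
    refine Subalgebra.sub_mem _ (ZariskiAffine.const_mem_polyFun _) ?_
    have h2 : (fun x : ZariskiAffine (Σ i, Fin (e i) × Fin (d i)) =>
        ∑ j, x.coord ⟨(s q).1, (s q).2, j⟩ * (b (s q).1).coord (Sum.inl j) (c q)) =
        ∑ j, (fun x => x.coord ⟨(s q).1, (s q).2, j⟩) *
          fun _ => (b (s q).1).coord (Sum.inl j) (c q) := by
      funext x
      simp [Finset.sum_apply]
    rw [h2]
    exact Subalgebra.sum_mem _ fun j _ => Subalgebra.mul_mem _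
      (ZariskiAffine.coord_mem_polyFun _) (ZariskiAffine.const_mem_polyFun _)
  · intro x hx
    rw [eq_bot_iff]
    intro v hv
    rw [Submodule.mem_iInf] at hv
    have h0 : (T x).mulVec (c.equivFun v) = 0 := by
      rw [hT]
      funext p
      rw [hL, coord_inr_of_mem_span_graphVec (b p.1) _ (hv p.1)]
      simp
    have h1 := Matrix.eq_zero_of_mulVec_eq_zero hx h0
    exact (Submodule.mem_bot ℂ).2 (c.equivFun.map_eq_zero_iff.1 h1)
  · intro hbot hdet
    obtain ⟨u, hu, hTu⟩ := Matrix.exists_mulVec_eq_zero_iff.2 hdet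
    have hLv : L ⟨0⟩ (c.equivFun.symm u) = 0 := by
      rw [← hT, LinearEquiv.apply_symm_apply, hTu]
    set v := c.equivFun.symm u with hv
    have hmem : v ∈ ⨅ i, (grChart b ⟨0⟩ i).1 := by
      rw [Submodule.mem_iInf]
      intro i
      rw [← (b i).sum_repr v, Fintype.sum_sum_type]
      refine Submodule.add_mem _ (Submodule.sum_mem _ fun j _ => Submodule.smul_mem _ _ ?_)
        (Submodule.sum_mem _ fun k _ => ?_)
      · have h : graphVec (b i) (fun _ _ => 0) j ∈ (grChart b ⟨0⟩ i).1 := graphVec_mem (b i) _ j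
        have h' : graphVec (b i) (fun _ _ => 0) j = b i (Sum.inl j) := by simp [graphVec]
        rwa [h'] at h
      · have h := congrFun hLv ⟨i, k⟩
        rw [hL] at h
        have h' : (b i).repr v (Sum.inr k) = 0 := by simpa using h
        rw [h', zero_smul]
        exact Submodule.zero_mem _
    rw [hbot, Submodule.mem_bot, hv, LinearEquiv.map_eq_zero_iff] at hmem
    exact hu hmem

end Triples

/-! ### The dimension of the feasible variety -/

/-- For three users, `d = 2N/3` and an `N`-dimensional complex vector space `V`, the feasible
variety in `∏ i, G(d, V)` has dimension `2N²/3` (an integer, since `3` divides `N`). -/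
theorem corollary4 {V : Type*} [AddCommGroup V] [Module ℂ V] [FiniteDimensional ℂ V]
    (N d : ℕ) (hN : Module.finrank ℂ V = N) (hd : 3 * d = 2 * N) :
    topologicalKrullDim (feasibleVariety V (fun _ : Fin 3 => d)) =
      ((2 * N ^ 2 / 3 : ℕ) : WithBot ℕ∞) := by
  obtain ⟨m, rfl, rfl⟩ : ∃ m, d = 2 * m ∧ N = 3 * m := ⟨N / 3, by omega, by omega⟩
  have hdim : 2 * (3 * m) ^ 2 / 3 = ∑ _i : Fin 3, m * (2 * m) := by
    simp only [Finset.sum_const, Finset.card_univ, Fintype.card_fin, smul_eq_mul]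
    rw [show 2 * (3 * m) ^ 2 = 3 * (m * (2 * m)) * 3 by ring, Nat.mul_div_cancel _ (by norm_num)]
  have hde : ∀ _i : Fin 3, Module.finrank ℂ V = 2 * m + m := fun _ => by omega
  rw [hdim]
  refine le_antisymm ((topologicalKrullDim_subspace_le _ _).trans
    (GrProd.topologicalKrullDim_le hde)) ?_
  obtain ⟨W, hW⟩ := exists_triple_inf_eq_bot hN
  obtain ⟨b, rfl⟩ := W.exists_grChart_zero_eq hde
  obtain ⟨g, hg, hgbot, hg0⟩ := exists_polyFun_iInf_grChart_eq_bot (by simp [hN]) b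
  have hmem : ∀ x : {x | g x ≠ 0}, grChart b x ∈ feasibleVariety V (fun _ : Fin 3 => 2 * m) :=
    fun x => isFeasibleStrategy_of_iInf_eq_bot hN _ (fun i => (grChart b x i).2) (hgbot x x.2)
  have hind := ((isInducing_grChart b).comp
    (Topology.IsInducing.subtypeVal (t := {x | g x ≠ 0}))).codRestrict hmem
  refine le_trans (le_of_eq ?_) ((ZariskiAffine.le_topologicalKrullDim
    (ZariskiAffine.isOpen_ne_zero hg) ⟨⟨0⟩, hg0 hW⟩).trans hind.topologicalKrullDim_le)
  simp
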